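/- Let $(M,J)$ be an almost complex manifold (a smooth finite-dimensional manifold without boundary with a smooth field $J$ of endomorphisms of $TM$, $J^2=-1$), let $(N,h)$ be a smooth finite-dimensional pseudo-Riemannian manifold with Levi-Civita connection $\nabla^h$, and let $\phi\colon M\to N$ be a smooth map. A smooth connection $D$ on $TM$ with $DJ=0$ is called a complex connection; it is of Nijenhuis type if its torsion $T(X,Y)=D_XY-D_YX-[X,Y]$ satisfies $T^{1,1}=0$. Here, with $TM\otimes\mathbb C=T^{1,0}M\oplus T^{0,1}M$ the splitting into the $\pm i$-eigenspaces of $J$, the $(1,1)$-part of a (vector-valued, complex bilinearly extended) bilinear form $B$ on $TM$ is $B^{1,1}(U,V)=B(U^{1,0},V^{0,1})+B(U^{0,1},V^{1,0})$. For a connection $D$ on $TM$ let $\nabla d\phi$ denote the tensor $$\nabla d\phi(X,Y)=(\phi^*\nabla^h)_X\big(d\phi(Y)\big)-d\phi(D_XY),$$ where $\nabla$ is the connection on $T^*M\otimes\phi^*TN$ induced by $D$ and $\nabla^h$. Then: (i) for every complex connection $D$ of Nijenhuis type, $(\nabla d\phi)^{1,1}$ is symmetric, i.e. $\nabla d\phi(Z,\bar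 W)=\nabla d\phi(\bar W,Z)$ for all $Z,W\in T^{1,0}M$ over the same point; (ii) the equation $(\nabla d\phi)^{1,1}=0$ does not depend on the choice of the complex connection of Nijenhuis type: if $D_1$ and $D_2$ are two such connections, it holds for $D_1$ if and only if it holds for $D_2$. Consequently, calling $\phi$ generalized pluriharmonic if $(\nabla d\phi)^{1,1}=0$ for some complex connection of Nijenhuis type, and given any complex connection $D$ of Nijenhuis type, $\phi$ is generalized pluriharmonic if and only if $(\nabla d\phi)^{1,1}=0$ for $D$. -/

import Mathlib

open scoped Manifold ContDiff TensorProduct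

noncomputable section

namespace Pluriharmonic

open Bundle FiberBundle VectorField

/-- A smooth pseudo-Riemannian metric on `N`: a smooth field of symmetric nondegenerate bilinear
forms on the tangent spaces. -/
structure PseudoRiemannianMetric (F : Type*) [NormedAddCommGroup F] [NormedSpace ℝ F]
    (N : Type*) [TopologicalSpace N] [ChartedSpace F N] [IsManifold 𝓘(ℝ, F) ∞ N] where
  toFun (p : N) : TangentSpace 𝓘(ℝ, F) p →L[ℝ] TangentSpace 𝓘(ℝ, F) p →L[ℝ] ℝ
  symm (p : N) (u v : TangentSpace 𝓘(ℝ, F) p) : toFun p u v = toFun p v u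
  nondegenerate (p : N) (u : TangentSpace 𝓘(ℝ, F) p) (hu : ∀ v, toFun p u v = 0) : u = 0
  contMDiff : ContMDiff 𝓘(ℝ, F) (𝓘(ℝ, F).prod 𝓘(ℝ, F →L[ℝ] F →L[ℝ] ℝ)) ∞
    (fun p : N ↦ TotalSpace.mk' (F →L[ℝ] F →L[ℝ] ℝ)
      (E := fun p : N ↦ TangentSpace 𝓘(ℝ, F) p →L[ℝ] TangentSpace 𝓘(ℝ, F) p →L[ℝ] ℝ) p (toFun p))

section LeviCivita
variable {F : Type*} [NormedAddCommGroup F] [NormedSpace ℝ F]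
    {N : Type*} [TopologicalSpace N] [ChartedSpace F N] [IsManifold 𝓘(ℝ, F) ∞ N]
    (h : PseudoRiemannianMetric F N)

namespace PseudoRiemannianMetric

instance : CoeFun (PseudoRiemannianMetric F N) fun _ ↦
    (p : N) → TangentSpace 𝓘(ℝ, F) p →L[ℝ] TangentSpace 𝓘(ℝ, F) p →L[ℝ] ℝ := ⟨toFun⟩

variable {h}
theorem mdifferentiableAt {p : N} {X Y : Π p : N, TangentSpace 𝓘(ℝ, F) p}
    (hX : MDiffAt (T% X) p) (hY : MDiffAt (T% Y) p) :
    MDiffAt (fun q ↦ h q (X q) (Y q)) p := by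
  have h1 : MDifferentiableAt 𝓘(ℝ, F) (𝓘(ℝ, F).prod 𝓘(ℝ, F →L[ℝ] F →L[ℝ] ℝ))
    (fun p : N ↦ TotalSpace.mk' (F →L[ℝ] F →L[ℝ] ℝ)
      (E := fun p : N ↦ TangentSpace 𝓘(ℝ, F) p →L[ℝ] TangentSpace 𝓘(ℝ, F) p →L[ℝ] ℝ) p (h p)) p :=
    (h.contMDiff p).mdifferentiableAt (by simp)
  have := MDifferentiableAt.clm_bundle_apply₂ (F₁ := F) (F₂ := F) (F₃ := ℝ)
    (E₁ := fun p : N ↦ TangentSpace 𝓘(ℝ, F) p) (E₂ := fun p : N ↦ TangentSpace 𝓘(ℝ, F) p)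
    (E₃ := Bundle.Trivial N ℝ) h1 hX hY
  simp only [mdifferentiableAt_totalSpace] at this
  exact this.2
variable (h)

theorem eq_of_forall {p : N} {u v : TangentSpace 𝓘(ℝ, F) p}
    (H : ∀ Z : Π p : N, TangentSpace 𝓘(ℝ, F) p, MDiffAt (T% Z) p →
      2 * h p u (Z p) = 2 * h p v (Z p)) : u = v := by
  rw [← sub_eq_zero]
  refine h.nondegenerate p _ fun w ↦ ?_
  have := H (extend F w) (mdifferentiableAt_extend ..)
  rw [extend_apply_self] at this
  rw [map_sub, sub_apply]
  linarith

variable [FiniteDimensional ℝ F]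

/-- The right-hand side of the Koszul formula
`2 h(∇_X Y, Z) = X h(Y, Z) + Y h(X, Z) - Z h(X, Y) + h([X, Y], Z) - h([X, Z], Y) - h([Y, Z], X)`. -/
def koszul (Y X Z : Π p : N, TangentSpace 𝓘(ℝ, F) p) (p : N) : ℝ :=
  d% (fun q ↦ h q (Y q) (Z q)) p (X p) + d% (fun q ↦ h q (X q) (Z q)) p (Y p)
    - d% (fun q ↦ h q (X q) (Y q)) p (Z p)
    + h p (mlieBracket 𝓘(ℝ, F) X Y p) (Z p) - h p (mlieBracket 𝓘(ℝ, F) X Z p) (Y p)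
    - h p (mlieBracket 𝓘(ℝ, F) Y Z p) (X p)

variable {h} in
theorem koszul_tensorial_left {p : N} {Y Z : Π p : N, TangentSpace 𝓘(ℝ, F) p}
    (hY : MDiffAt (T% Y) p) (hZ : MDiffAt (T% Z) p) :
    TensorialAt 𝓘(ℝ, F) F (fun X ↦ h.koszul Y X Z p) p where
  smul {f X} hf hX := by
    have e1 : (fun q ↦ h q ((f • X) q) (Z q)) = f * fun q ↦ h q (X q) (Z q) := by
      ext q; simp
    have e2 : (fun q ↦ h q ((f • X) q) (Y q)) = f * fun q ↦ h q (X q) (Y q) := by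
      ext q; simp
    simp only [koszul]
    rw [e1, e2, mvfderiv_mul hf (h.mdifferentiableAt hX hZ),
      mvfderiv_mul hf (h.mdifferentiableAt hX hY), mlieBracket_smul_left hf hX,
      mlieBracket_smul_left hf hX]
    simp only [Pi.smul_apply', map_smul, map_add, map_neg, add_apply, smul_apply, neg_apply,
      smul_eq_mul, neg_smul]
    ring
  add {X X'} hX hX' := by
    have e1 : ∀ W : Π p : N, TangentSpace 𝓘(ℝ, F) p, (fun q ↦ h q ((X + X') q) (W q)) =
      (fun q ↦ h q (X q) (W q)) + fun q ↦ h q (X' q) (W q) := by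
      intro W; ext q; simp
    simp only [koszul]
    rw [e1, e1, mvfderiv_add (h.mdifferentiableAt hX hZ) (h.mdifferentiableAt hX' hZ),
      mvfderiv_add (h.mdifferentiableAt hX hY) (h.mdifferentiableAt hX' hY),
      mlieBracket_add_left hX hX', mlieBracket_add_left hX hX']
    simp only [Pi.add_apply, map_add, add_apply]
    ring

variable {h} in
theorem koszul_tensorial_right {p : N} {Y X : Π p : N, TangentSpace 𝓘(ℝ, F) p}
    (hY : MDiffAt (T% Y) p) (hX : MDiffAt (T% X) p) :
    TensorialAt 𝓘(ℝ, F) F (fun Z ↦ h.koszul Y X Z p) p where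
  smul {f Z} hf hZ := by
    have e1 : ∀ W : Π p : N, TangentSpace 𝓘(ℝ, F) p, (fun q ↦ h q (W q) ((f • Z) q)) = f * fun q ↦ h q (W q) (Z q) := by
      intro W; ext q; simp
    simp only [koszul]
    rw [e1, e1, mvfderiv_mul hf (h.mdifferentiableAt hX hZ),
      mvfderiv_mul hf (h.mdifferentiableAt hY hZ), mlieBracket_smul_right hf hZ,
      mlieBracket_smul_right hf hZ]
    simp only [Pi.smul_apply', map_smul, map_add, add_apply, smul_apply, smul_eq_mul]
    rw [h.symm p (Z p) (X p), h.symm p (Z p) (Y p)]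
    ring
  add {Z Z'} hZ hZ' := by
    have e1 : ∀ W : Π p : N, TangentSpace 𝓘(ℝ, F) p, (fun q ↦ h q (W q) ((Z + Z') q)) =
      (fun q ↦ h q (W q) (Z q)) + fun q ↦ h q (W q) (Z' q) := by
      intro W; ext q; simp
    simp only [koszul]
    rw [e1, e1, mvfderiv_add (h.mdifferentiableAt hX hZ) (h.mdifferentiableAt hX hZ'),
      mvfderiv_add (h.mdifferentiableAt hY hZ) (h.mdifferentiableAt hY hZ'),
      mlieBracket_add_right hZ hZ', mlieBracket_add_right hZ hZ']
    simp only [Pi.add_apply, map_add, add_apply]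
    ring

/-- The isomorphism `T_pN ≃ (T_pN)^*` given by the metric. -/
def flat (p : N) : TangentSpace 𝓘(ℝ, F) p ≃ₗ[ℝ] (TangentSpace 𝓘(ℝ, F) p →L[ℝ] ℝ) :=
  have : FiniteDimensional ℝ (TangentSpace 𝓘(ℝ, F) p) := inferInstanceAs (FiniteDimensional ℝ F)
  LinearEquiv.ofInjectiveOfFinrankEq (h p).toLinearMap
    ((injective_iff_map_eq_zero _).2 fun u hu ↦ h.nondegenerate p u fun v ↦ DFunLike.congr_fun hu v)
    (by
      have : T2Space (TangentSpace 𝓘(ℝ, F) p) := inferInstanceAs (T2Space F)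
      rw [← (LinearMap.toContinuousLinearMap (𝕜 := ℝ) (E := TangentSpace 𝓘(ℝ, F) p)
        (F' := ℝ)).finrank_eq]
      exact (Subspace.dual_finrank_eq (K := ℝ) (V := TangentSpace 𝓘(ℝ, F) p)).symm)

theorem flat_apply (p : N) (u v : TangentSpace 𝓘(ℝ, F) p) : h.flat p u v = h p u v := rfl

open Classical in
/-- The Levi-Civita connection as a map on vector fields, through the Koszul formula. As everywhere
in `CovariantDerivative`, only its values at points of differentiability of `Y` matter. -/
def leviCivitaFun (Y : Π p : N, TangentSpace 𝓘(ℝ, F) p) (p : N) :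
    TangentSpace 𝓘(ℝ, F) p →L[ℝ] TangentSpace 𝓘(ℝ, F) p :=
  have : FiniteDimensional ℝ (TangentSpace 𝓘(ℝ, F) p) := inferInstanceAs (FiniteDimensional ℝ F)
  have : T2Space (TangentSpace 𝓘(ℝ, F) p) := inferInstanceAs (T2Space F)
  if hY : MDiffAt (T% Y) p then
    LinearMap.toContinuousLinearMap <| (1 / 2 : ℝ) • (h.flat p).symm.toLinearMap ∘ₗ
      (TensorialAt.mkHom₂ (fun X Z ↦ h.koszul Y X Z p) p
        (fun _ hZ ↦ koszul_tensorial_left hY hZ)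
        (fun _ hX ↦ koszul_tensorial_right hY hX)).toLinearMap
  else 0

theorem leviCivitaFun_apply {X Y Z : Π p : N, TangentSpace 𝓘(ℝ, F) p} {p : N}
    (hX : MDiffAt (T% X) p) (hY : MDiffAt (T% Y) p) (hZ : MDiffAt (T% Z) p) :
    2 * h p (h.leviCivitaFun Y p (X p)) (Z p) = h.koszul Y X Z p := by
  simp only [leviCivitaFun, hY, dif_pos]
  rw [← flat_apply]
  simp
  rw [TensorialAt.mkHom₂_apply _ _ hX hZ]

/-- The Levi-Civita connection of `h`. -/
def leviCivita : CovariantDerivative 𝓘(ℝ, F) F (TangentSpace 𝓘(ℝ, F) : N → Type _) where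
  toFun := h.leviCivitaFun
  isCovariantDerivativeOnUniv :=
    { add := by
        intro Y Y' p hY hY' _
        ext u
        refine h.eq_of_forall fun Z hZ ↦ ?_
        have hX : MDiffAt (T% (extend F u)) p := mdifferentiableAt_extend ..
        have hYY : MDiffAt (T% (Y + Y')) p := mdifferentiableAt_add_section hY hY'
        have k1 := h.leviCivitaFun_apply hX hY hZ
        have k2 := h.leviCivitaFun_apply hX hY' hZ
        have k3 := h.leviCivitaFun_apply hX hYY hZ
        rw [extend_apply_self] at k1 k2 k3
        rw [add_apply, map_add, add_apply, mul_add, k1, k2, k3]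
        have e1 : ∀ W : Π p : N, TangentSpace 𝓘(ℝ, F) p, (fun q ↦ h q (W q) ((Y + Y') q)) =
          (fun q ↦ h q (W q) (Y q)) + fun q ↦ h q (W q) (Y' q) := by
          intro W; ext q; simp
        have e2 : ∀ W : Π p : N, TangentSpace 𝓘(ℝ, F) p, (fun q ↦ h q ((Y + Y') q) (W q)) =
          (fun q ↦ h q (Y q) (W q)) + fun q ↦ h q (Y' q) (W q) := by
          intro W; ext q; simp
        simp only [koszul]
        rw [e1, e2, mvfderiv_add (h.mdifferentiableAt hX hY) (h.mdifferentiableAt hX hY'),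
          mvfderiv_add (h.mdifferentiableAt hY hZ) (h.mdifferentiableAt hY' hZ),
          mlieBracket_add_right hY hY', mlieBracket_add_left hY hY']
        simp only [Pi.add_apply, map_add, add_apply]
        ring
      leibniz := by
        intro Y g p hY hg _
        ext u
        refine h.eq_of_forall fun Z hZ ↦ ?_
        have hX : MDiffAt (T% (extend F u)) p := mdifferentiableAt_extend ..
        have hgY : MDiffAt (T% (g • Y)) p := hg.smul_section hY
        have k1 := h.leviCivitaFun_apply hX hY hZ
        have k3 := h.leviCivitaFun_apply hX hgY hZ
        have hu : extend F u p = u := extend_apply_self ..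
        rw [hu] at k1 k3
        rw [add_apply, map_add, add_apply, mul_add, k3, smul_apply, map_smul, smul_apply,
          smul_eq_mul, mul_left_comm, k1]
        have e1 : ∀ W : Π p : N, TangentSpace 𝓘(ℝ, F) p, (fun q ↦ h q (W q) ((g • Y) q)) = g * (fun q ↦ h q (W q) (Y q)) := by
          intro W; ext q; simp
        have e2 : ∀ W : Π p : N, TangentSpace 𝓘(ℝ, F) p, (fun q ↦ h q ((g • Y) q) (W q)) = g * fun q ↦ h q (Y q) (W q) := by
          intro W; ext q; simp
        simp only [koszul]
        rw [e1, e2, mvfderiv_mul hg (h.mdifferentiableAt hX hY),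
          mvfderiv_mul hg (h.mdifferentiableAt hY hZ),
          mlieBracket_smul_right hg hY, mlieBracket_smul_left hg hY]
        simp only [Pi.smul_apply', map_smul, map_add, map_neg, add_apply, smul_apply, neg_apply,
          smul_eq_mul, neg_smul, hu, ContinuousLinearMap.smulRight_apply]
        rw [h.symm p u (Y p)]
        ring }

/-- The Levi-Civita connection is torsion-free. -/
theorem leviCivita_torsion : h.leviCivita.torsion = 0 := by
  rw [CovariantDerivative.torsion_eq_zero_iff]
  intro X Y p hX hY
  refine h.eq_of_forall fun Z hZ ↦ ?_
  have k1 := h.leviCivitaFun_apply hX hY hZ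
  have k2 := h.leviCivitaFun_apply hY hX hZ
  change 2 * h p (h.leviCivitaFun Y p (X p) - h.leviCivitaFun X p (Y p)) (Z p) = _
  rw [map_sub, sub_apply, mul_sub, k1, k2]
  simp only [koszul]
  rw [mlieBracket_swap_apply (V := Y) (W := X)]
  have e1 : (fun q ↦ h q (X q) (Y q)) = (fun q ↦ h q (Y q) (X q)) := by
    ext q; exact h.symm q _ _
  rw [e1]
  simp only [map_neg, neg_apply]
  ring

/-- The Levi-Civita connection is metric: `X h(Y, Z) = h(∇_X Y, Z) + h(Y, ∇_X Z)`. -/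
theorem leviCivita_metric {X Y Z : Π p : N, TangentSpace 𝓘(ℝ, F) p} {p : N}
    (hX : MDiffAt (T% X) p) (hY : MDiffAt (T% Y) p) (hZ : MDiffAt (T% Z) p) :
    d% (fun q ↦ h q (Y q) (Z q)) p (X p) =
      h p (h.leviCivita Y p (X p)) (Z p) + h p (Y p) (h.leviCivita Z p (X p)) := by
  have k1 := h.leviCivitaFun_apply hX hY hZ
  have k2 := h.leviCivitaFun_apply hX hZ hY
  rw [h.symm p (Y p)]
  change _ = h p (h.leviCivitaFun Y p (X p)) (Z p) + h p (h.leviCivitaFun Z p (X p)) (Y p)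
  simp only [koszul] at k1 k2
  rw [mlieBracket_swap_apply (V := Z) (W := Y)] at k2
  have e1 : (fun q ↦ h q (Z q) (Y q)) = (fun q ↦ h q (Y q) (Z q)) := by
    ext q; exact h.symm q _ _
  rw [e1] at k2
  simp only [map_neg, neg_apply] at k2
  linarith

end PseudoRiemannianMetric
end LeviCivita
section Pullback

variable {E : Type*} [NormedAddCommGroup E] [NormedSpace ℝ E]
  {M : Type*} [TopologicalSpace M] [ChartedSpace E M]
  {F : Type*} [NormedAddCommGroup F] [NormedSpace ℝ F]
  {N : Type*} [TopologicalSpace N] [ChartedSpace F N] [IsManifold 𝓘(ℝ, F) ∞ N]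
  (φ : C^∞⟮𝓘(ℝ, E), M; 𝓘(ℝ, F), N⟯)
  (cov : CovariantDerivative 𝓘(ℝ, F) F (TangentSpace 𝓘(ℝ, F) : N → Type _))

/-- The vector field around `p` that is constantly equal to `w` in the trivialization of the
tangent bundle around `p`. -/
def constField (p : N) (w : F) (q : N) : TangentSpace 𝓘(ℝ, F) q :=
  (trivializationAt F (TangentSpace 𝓘(ℝ, F)) p).symmL ℝ q w

theorem mdifferentiableAt_constField (p : N) (w : F) : MDiffAt (T% (constField p w)) p := by
  rw [mdifferentiableAt_section]
  refine (mdifferentiableAt_const (c := w)).congr_of_eventuallyEq ?_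
  filter_upwards [(trivializationAt F (TangentSpace 𝓘(ℝ, F)) p).open_baseSet.mem_nhds
    (mem_baseSet_trivializationAt F (TangentSpace 𝓘(ℝ, F)) p)] with q hq
  simp only [constField]
  rw [Trivialization.symmL_apply _ hq, Trivialization.apply_mk_symm _ hq]

/-- The coordinates of a vector field `σ` along `φ`, in the trivialization of `TN` around `φ x`. -/
def coord (σ : Π y : M, TangentSpace 𝓘(ℝ, F) (φ y)) (x y : M) : F :=
  (trivializationAt F (TangentSpace 𝓘(ℝ, F)) (φ x)).continuousLinearMapAt ℝ (φ y) (σ y)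

theorem mdifferentiableAt_coord {σ : Π y : M, TangentSpace 𝓘(ℝ, F) (φ y)} {x : M}
    (hσ : MDiffAt (fun y ↦ (TotalSpace.mk' F (φ y) (σ y) : TangentBundle 𝓘(ℝ, F) N)) x) :
    MDiffAt (coord φ σ x) x := by
  refine ((mdifferentiableAt_totalSpace _ _).1 hσ).2.congr_of_eventuallyEq ?_
  have : ∀ᶠ y in nhds x, φ y ∈ (trivializationAt F (TangentSpace 𝓘(ℝ, F)) (φ x)).baseSet :=
    (map_continuous φ).continuousAt.eventually_mem
      ((trivializationAt F (TangentSpace 𝓘(ℝ, F)) (φ x)).open_baseSet.mem_nhds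
        (mem_baseSet_trivializationAt F (TangentSpace 𝓘(ℝ, F)) (φ x)))
  filter_upwards [this] with y hy
  exact congrFun (Trivialization.coe_linearMapAt_of_mem
    (trivializationAt F (TangentSpace 𝓘(ℝ, F)) (φ x)) hy) (σ y)

/-- The pull-back connection `φ^*∇` on `φ^*TN`, acting on vector fields `σ` along `φ`. In a local
trivialization of `TN` around `φ x`, with `σ = ∑ σ^i (e_i ∘ φ)` for the constant frame `e_i`, it is
`(φ^*∇)_X σ = ∑ dσ^i(X) e_i + σ^i ∇_{dφ X} e_i`. -/
def pullbackConnection (σ : Π y : M, TangentSpace 𝓘(ℝ, F) (φ y)) (x : M) :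
    TangentSpace 𝓘(ℝ, E) x →L[ℝ] TangentSpace 𝓘(ℝ, F) (φ x) :=
  (trivializationAt F (TangentSpace 𝓘(ℝ, F)) (φ x)).symmL ℝ (φ x) ∘L d% (coord φ σ x) x
    + cov (constField (φ x) (coord φ σ x x)) (φ x) ∘L mfderiv 𝓘(ℝ, E) 𝓘(ℝ, F) φ x

theorem pullbackConnection_add {σ σ' : Π y : M, TangentSpace 𝓘(ℝ, F) (φ y)} {x : M}
    (hσ : MDiffAt (fun y ↦ (TotalSpace.mk' F (φ y) (σ y) : TangentBundle 𝓘(ℝ, F) N)) x)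
    (hσ' : MDiffAt (fun y ↦ (TotalSpace.mk' F (φ y) (σ' y) : TangentBundle 𝓘(ℝ, F) N)) x) :
    pullbackConnection φ cov (σ + σ') x =
      pullbackConnection φ cov σ x + pullbackConnection φ cov σ' x := by
  have h1 : coord φ (σ + σ') x = coord φ σ x + coord φ σ' x := by
    ext y; exact map_add _ _ _
  have h2 : ∀ w w' : F, constField (φ x) (w + w') = constField (φ x) w + constField (φ x) w' := by
    intro w w'; ext y; exact map_add _ _ _
  ext X
  simp only [pullbackConnection]
  rw [h1, mvfderiv_add (mdifferentiableAt_coord φ hσ) (mdifferentiableAt_coord φ hσ')]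
  rw [Pi.add_apply, h2, cov.isCovariantDerivativeOnUniv.add (mdifferentiableAt_constField _ _)
    (mdifferentiableAt_constField _ _)]
  simp only [add_apply, ContinuousLinearMap.comp_apply, map_add]
  exact add_add_add_comm _ _ _ _

theorem pullbackConnection_smul {σ : Π y : M, TangentSpace 𝓘(ℝ, F) (φ y)} {g : M → ℝ} {x : M}
    (hσ : MDiffAt (fun y ↦ (TotalSpace.mk' F (φ y) (σ y) : TangentBundle 𝓘(ℝ, F) N)) x)
    (hg : MDiffAt g x) :
    pullbackConnection φ cov (fun y ↦ g y • σ y) x =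
      g x • pullbackConnection φ cov σ x + (d% g x).smulRight (σ x) := by
  have h1 : coord φ (fun y ↦ g y • σ y) x = g • coord φ σ x := by
    ext y; exact map_smul _ _ _
  have h2 : ∀ (c : ℝ) (w : F), constField (φ x) (c • w) = c • constField (φ x) w := by
    intro c w; ext y; exact map_smul _ _ _
  have h3 : (g • coord φ σ x) x = g x • coord φ σ x x := rfl
  have h4 : (trivializationAt F (TangentSpace 𝓘(ℝ, F)) (φ x)).symmL ℝ (φ x) (coord φ σ x x) = σ x :=
    Trivialization.symmL_continuousLinearMapAt _
      (mem_baseSet_trivializationAt F (TangentSpace 𝓘(ℝ, F)) (φ x)) _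
  ext X
  simp only [pullbackConnection]
  rw [h1, mvfderiv_smul hg (mdifferentiableAt_coord φ hσ)]
  rw [h3, h2, cov.isCovariantDerivativeOnUniv.smul_const _ (mdifferentiableAt_constField _ _)]
  simp only [add_apply, ContinuousLinearMap.comp_apply, map_add,
    smul_apply, ContinuousLinearMap.smulRight_apply, map_smul, h4, smul_add]
  exact add_right_comm _ _ _

/-- The pull-back connection is characterized by `(φ^*∇)_X (s ∘ φ) = ∇_{dφ X} s`. -/
theorem pullbackConnection_comp [FiniteDimensional ℝ F] {x : M}
    {s : Π p : N, TangentSpace 𝓘(ℝ, F) p} (hs : MDiffAt (T% s) (φ x)) (X : TangentSpace 𝓘(ℝ, E) x) :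
    pullbackConnection φ cov (fun y ↦ s (φ y)) x X =
      cov s (φ x) (mfderiv 𝓘(ℝ, E) 𝓘(ℝ, F) φ x X) := by
  set e := trivializationAt F (TangentSpace 𝓘(ℝ, F)) (φ x) with he
  have hmem : φ x ∈ e.baseSet := mem_baseSet_trivializationAt F (TangentSpace 𝓘(ℝ, F)) (φ x)
  have hφ : MDiffAt φ x := (φ.contMDiff x).mdifferentiableAt (by simp)
  have hc : ∀ {s : Π p : N, TangentSpace 𝓘(ℝ, F) p}, MDiffAt (T% s) (φ x) →
      MDiffAt (fun q ↦ e.continuousLinearMapAt ℝ q (s q)) (φ x) := by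
    intro s hs
    refine ((mdifferentiableAt_section _ _).1 hs).congr_of_eventuallyEq ?_
    filter_upwards [e.open_baseSet.mem_nhds hmem] with q hq
    exact congrFun (Trivialization.coe_linearMapAt_of_mem e hq) (s q)
  have hT : TensorialAt 𝓘(ℝ, F) F (fun s : Π p : N, TangentSpace 𝓘(ℝ, F) p ↦
      cov s (φ x) - e.symmL ℝ (φ x) ∘L d% (fun q ↦ e.continuousLinearMapAt ℝ q (s q)) (φ x))
      (φ x) := by
    constructor
    · intro f s hf hs
      have h1 : (fun q ↦ e.continuousLinearMapAt ℝ q ((f • s) q)) =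
          f • fun q ↦ e.continuousLinearMapAt ℝ q (s q) := by
        ext q; exact map_smul _ _ _
      have h4 : e.symmL ℝ (φ x) (e.continuousLinearMapAt ℝ (φ x) (s (φ x))) = s (φ x) :=
        Trivialization.symmL_continuousLinearMapAt _ hmem _
      ext X
      rw [h1, mvfderiv_smul hf (hc hs), cov.isCovariantDerivativeOnUniv.leibniz hs hf]
      simp only [add_apply, sub_apply, ContinuousLinearMap.comp_apply, map_add, smul_apply,
        ContinuousLinearMap.smulRight_apply, map_smul, h4, smul_sub]
      exact add_sub_add_right_eq_sub _ _ _
    · intro s s' hs hs'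
      have h1 : (fun q ↦ e.continuousLinearMapAt ℝ q ((s + s') q)) =
          (fun q ↦ e.continuousLinearMapAt ℝ q (s q)) +
            fun q ↦ e.continuousLinearMapAt ℝ q (s' q) := by
        ext q; exact map_add _ _ _
      ext X
      rw [h1, mvfderiv_add (hc hs) (hc hs'), cov.isCovariantDerivativeOnUniv.add hs hs']
      simp only [add_apply, sub_apply, ContinuousLinearMap.comp_apply, map_add]
      exact add_sub_add_comm _ _ _ _
  have h4 : e.symmL ℝ (φ x) (e.continuousLinearMapAt ℝ (φ x) (s (φ x))) = s (φ x) :=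
    Trivialization.symmL_continuousLinearMapAt _ hmem _
  have hp := hT.pointwise hs (mdifferentiableAt_constField (φ x) (coord φ (fun y ↦ s (φ y)) x x))
    h4.symm
  have h0 : d% (fun q ↦ e.continuousLinearMapAt ℝ q
      (constField (φ x) (coord φ (fun y ↦ s (φ y)) x x) q)) (φ x) = 0 := by
    have : (fun q ↦ e.continuousLinearMapAt ℝ q
        (constField (φ x) (coord φ (fun y ↦ s (φ y)) x x) q)) =ᶠ[nhds (φ x)]
        fun _ ↦ coord φ (fun y ↦ s (φ y)) x x := by
      filter_upwards [e.open_baseSet.mem_nhds hmem] with q hq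
      exact Trivialization.continuousLinearMapAt_symmL e hq _
    simp only [mvfderiv, this.mfderiv_eq, mfderiv_const]
    exact ContinuousLinearMap.comp_zero _
  simp only [h0, ContinuousLinearMap.comp_zero, sub_zero] at hp
  simp only [pullbackConnection, ← hp]
  have h5 : d% (coord φ (fun y ↦ s (φ y)) x) x = d% (fun q ↦ e.continuousLinearMapAt ℝ q (s q)) (φ x)
      ∘L mfderiv 𝓘(ℝ, E) 𝓘(ℝ, F) φ x := by
    have := mfderiv_comp x (hc hs) hφ
    ext Y
    exact DFunLike.congr_fun this Y
  rw [h5]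
  simp only [add_apply, sub_apply, ContinuousLinearMap.comp_apply]
  exact add_sub_cancel _ _

variable [IsManifold 𝓘(ℝ, E) ∞ M]

theorem mdifferentiableAt_mfderiv_apply {Y : Π y : M, TangentSpace 𝓘(ℝ, E) y} {x : M}
    (hY : MDiffAt (T% Y) x) :
    MDiffAt (fun y ↦ (TotalSpace.mk' F (φ y) (mfderiv 𝓘(ℝ, E) 𝓘(ℝ, F) φ y (Y y)) :
      TangentBundle 𝓘(ℝ, F) N)) x := by
  have h1 : ContMDiff 𝓘(ℝ, E).tangent 𝓘(ℝ, F).tangent 1 (tangentMap 𝓘(ℝ, E) 𝓘(ℝ, F) φ) :=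
    φ.contMDiff.contMDiff_tangentMap (by norm_cast)
  exact ((h1 _).mdifferentiableAt one_ne_zero).comp x hY

variable
  (D : CovariantDerivative 𝓘(ℝ, E) E (TangentSpace 𝓘(ℝ, E) : M → Type _))

theorem nablaDifferential_tensorial (x : M) :
    TensorialAt 𝓘(ℝ, E) E (fun Y : Π y : M, TangentSpace 𝓘(ℝ, E) y ↦
      pullbackConnection φ cov (fun y ↦ mfderiv 𝓘(ℝ, E) 𝓘(ℝ, F) φ y (Y y)) x
        - mfderiv 𝓘(ℝ, E) 𝓘(ℝ, F) φ x ∘L D Y x) x where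
  smul {f Y} hf hY := by
    have e : (fun y ↦ mfderiv 𝓘(ℝ, E) 𝓘(ℝ, F) φ y ((f • Y) y)) =
        fun y ↦ f y • mfderiv 𝓘(ℝ, E) 𝓘(ℝ, F) φ y (Y y) := by
      ext y; exact map_smul _ _ _
    rw [e, pullbackConnection_smul φ cov (mdifferentiableAt_mfderiv_apply φ hY) hf,
      D.isCovariantDerivativeOnUniv.leibniz hY hf]
    ext X
    simp only [add_apply, sub_apply, ContinuousLinearMap.comp_apply, map_add, smul_apply,
        ContinuousLinearMap.smulRight_apply, map_smul, smul_sub]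
    exact add_sub_add_right_eq_sub _ _ _
  add {Y Y'} hY hY' := by
    have e : (fun y ↦ mfderiv 𝓘(ℝ, E) 𝓘(ℝ, F) φ y ((Y + Y') y)) =
        (fun y ↦ mfderiv 𝓘(ℝ, E) 𝓘(ℝ, F) φ y (Y y)) +
          fun y ↦ mfderiv 𝓘(ℝ, E) 𝓘(ℝ, F) φ y (Y' y) := by
      ext y; exact map_add _ _ _
    rw [e, pullbackConnection_add φ cov (mdifferentiableAt_mfderiv_apply φ hY)
      (mdifferentiableAt_mfderiv_apply φ hY'), D.isCovariantDerivativeOnUniv.add hY hY']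
    ext X
    simp only [add_apply, sub_apply, ContinuousLinearMap.comp_apply, map_add]
    exact add_sub_add_comm _ _ _ _

variable [FiniteDimensional ℝ E]

/-- The tensor `∇dφ`, for the connection `∇` on `T^*M ⊗ φ^*TN` that is induced by a connection `D`
on `M` and a connection `cov` on `N`:
`∇dφ(X, Y) = (φ^*cov)_X (dφ Y) - dφ(D_X Y)`, which is tensorial in `Y`. -/
def nablaDifferential (x : M) :
    TangentSpace 𝓘(ℝ, E) x →ₗ[ℝ] TangentSpace 𝓘(ℝ, E) x →ₗ[ℝ] TangentSpace 𝓘(ℝ, F) (φ x) :=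
  (ContinuousLinearMap.coeLM ℝ ∘ₗ
    (TensorialAt.mkHom _ x (nablaDifferential_tensorial φ cov D x)).toLinearMap).flip

theorem nablaDifferential_apply {x : M} (u : TangentSpace 𝓘(ℝ, E) x)
    {Y : Π y : M, TangentSpace 𝓘(ℝ, E) y} (hY : MDiffAt (T% Y) x) :
    nablaDifferential φ cov D x u (Y x) =
      pullbackConnection φ cov (fun y ↦ mfderiv 𝓘(ℝ, E) 𝓘(ℝ, F) φ y (Y y)) x u
        - mfderiv 𝓘(ℝ, E) 𝓘(ℝ, F) φ x (D Y x u) := by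
  have := TensorialAt.mkHom_apply (nablaDifferential_tensorial φ cov D x) hY
  exact DFunLike.congr_fun this u

end Pullback

section Complexification

variable {V : Type*} [AddCommGroup V] [Module ℝ V] {W : Type*} [AddCommGroup W] [Module ℝ W]

/-- Complex conjugation on the complexification `ℂ ⊗ V`. -/
def conj : ℂ ⊗[ℝ] V →ₗ[ℝ] ℂ ⊗[ℝ] V := Complex.conjAe.toLinearMap.rTensor V

/-- The subspace `V^{1,0} = {Z | J Z = i Z}` of `ℂ ⊗ V`, for a complex structure `J` on `V`. -/
def type10 (J : V →ₗ[ℝ] V) : Submodule ℂ (ℂ ⊗[ℝ] V) :=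
  Module.End.eigenspace (J.baseChange ℂ) Complex.I

/-- The projection `(1 - i J) / 2` of `ℂ ⊗ V` onto `V^{1,0}`. -/
def proj10 (J : V →ₗ[ℝ] V) : ℂ ⊗[ℝ] V →ₗ[ℂ] ℂ ⊗[ℝ] V :=
  (1 / 2 : ℂ) • (LinearMap.id - Complex.I • J.baseChange ℂ)

/-- The projection `(1 + i J) / 2` of `ℂ ⊗ V` onto `V^{0,1}`. -/
def proj01 (J : V →ₗ[ℝ] V) : ℂ ⊗[ℝ] V →ₗ[ℂ] ℂ ⊗[ℝ] V :=
  (1 / 2 : ℂ) • (LinearMap.id + Complex.I • J.baseChange ℂ)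

/-- The complex bilinear extension of a real bilinear map. -/
def complexify (B : V →ₗ[ℝ] V →ₗ[ℝ] W) : ℂ ⊗[ℝ] V →ₗ[ℂ] ℂ ⊗[ℝ] V →ₗ[ℂ] ℂ ⊗[ℝ] W :=
  LinearMap.BilinMap.baseChange ℂ B

/-- The `(1,1)`-part of (the complex bilinear extension of) a bilinear map `B`, that is
`B^{1,1}(U, V) = B(U^{1,0}, V^{0,1}) + B(U^{0,1}, V^{1,0})`. -/
def oneOnePart (J : V →ₗ[ℝ] V) (B : V →ₗ[ℝ] V →ₗ[ℝ] W) :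
    ℂ ⊗[ℝ] V →ₗ[ℂ] ℂ ⊗[ℝ] V →ₗ[ℂ] ℂ ⊗[ℝ] W :=
  (complexify B).compl₁₂ (proj10 J) (proj01 J) + (complexify B).compl₁₂ (proj01 J) (proj10 J)

end Complexification

section AlmostComplex

/-- An almost complex structure on `M`: a smooth field `J` of endomorphisms of the tangent spaces
with `J² = -1`. -/
structure AlmostComplexStructure (E : Type*) [NormedAddCommGroup E] [NormedSpace ℝ E]
    (M : Type*) [TopologicalSpace M] [ChartedSpace E M] [IsManifold 𝓘(ℝ, E) ∞ M] where
  toFun (x : M) : TangentSpace 𝓘(ℝ, E) x →L[ℝ] TangentSpace 𝓘(ℝ, E) x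
  sq (x : M) (u : TangentSpace 𝓘(ℝ, E) x) : toFun x (toFun x u) = -u
  contMDiff : ContMDiff 𝓘(ℝ, E) (𝓘(ℝ, E).prod 𝓘(ℝ, E →L[ℝ] E)) ∞
    (fun x : M ↦ TotalSpace.mk' (E →L[ℝ] E)
      (E := fun x : M ↦ TangentSpace 𝓘(ℝ, E) x →L[ℝ] TangentSpace 𝓘(ℝ, E) x) x (toFun x))

variable {E : Type*} [NormedAddCommGroup E] [NormedSpace ℝ E] [FiniteDimensional ℝ E]
  {M : Type*} [TopologicalSpace M] [ChartedSpace E M] [IsManifold 𝓘(ℝ, E) ∞ M]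
  {F : Type*} [NormedAddCommGroup F] [NormedSpace ℝ F] [FiniteDimensional ℝ F]
  {N : Type*} [TopologicalSpace N] [ChartedSpace F N] [IsManifold 𝓘(ℝ, F) ∞ N]

instance : CoeFun (AlmostComplexStructure E M) fun _ ↦
    (x : M) → TangentSpace 𝓘(ℝ, E) x →L[ℝ] TangentSpace 𝓘(ℝ, E) x :=
  ⟨AlmostComplexStructure.toFun⟩

/-- The torsion of a connection at `x`, as a bilinear map. -/
def torsionAt (D : CovariantDerivative 𝓘(ℝ, E) E (TangentSpace 𝓘(ℝ, E) : M → Type _)) (x : M) :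
    TangentSpace 𝓘(ℝ, E) x →ₗ[ℝ] TangentSpace 𝓘(ℝ, E) x →ₗ[ℝ] TangentSpace 𝓘(ℝ, E) x :=
  ContinuousLinearMap.coeLM ℝ ∘ₗ (D.torsion x).toLinearMap

/-- A complex connection: a smooth connection `D` on `TM` with `DJ = 0`, that is
`D_X (J Y) = J (D_X Y)`. -/
structure IsComplexConnection (J : AlmostComplexStructure E M)
    (D : CovariantDerivative 𝓘(ℝ, E) E (TangentSpace 𝓘(ℝ, E) : M → Type _)) : Prop where
  smooth : CovariantDerivative.ContMDiffCovariantDerivative D ∞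
  parallel : ∀ {Y : Π x : M, TangentSpace 𝓘(ℝ, E) x} {x : M}, MDiffAt (T% Y) x →
    ∀ u : TangentSpace 𝓘(ℝ, E) x, D (fun y ↦ J y (Y y)) x u = J x (D Y x u)

/-- A complex connection of Nijenhuis type: its torsion `T` satisfies `T^{1,1} = 0`. -/
structure IsNijenhuisType (J : AlmostComplexStructure E M)
    (D : CovariantDerivative 𝓘(ℝ, E) E (TangentSpace 𝓘(ℝ, E) : M → Type _)) : Prop
    extends IsComplexConnection J D where
  torsion_oneOne : ∀ x : M, oneOnePart (J x).toLinearMap (torsionAt D x) = 0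

variable (J : AlmostComplexStructure E M) (h : PseudoRiemannianMetric F N)
  (φ : C^∞⟮𝓘(ℝ, E), M; 𝓘(ℝ, F), N⟯)

/-- The equation `(∇dφ)^{1,1} = 0`, where `∇` is induced by a connection `D` on `M` and the
Levi-Civita connection of `h`. -/
def PluriharmonicEquation
    (D : CovariantDerivative 𝓘(ℝ, E) E (TangentSpace 𝓘(ℝ, E) : M → Type _)) : Prop :=
  ∀ x : M, oneOnePart (J x).toLinearMap (nablaDifferential φ h.leviCivita D x) = 0

/-- `φ` is generalized pluriharmonic: it satisfies `(∇dφ)^{1,1} = 0`, where `∇` is induced by a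
complex connection of Nijenhuis type on `M` and the Levi-Civita connection of `h`. -/
def IsGeneralizedPluriharmonic : Prop :=
  ∃ D : CovariantDerivative 𝓘(ℝ, E) E (TangentSpace 𝓘(ℝ, E) : M → Type _),
    IsNijenhuisType J D ∧ PluriharmonicEquation J h φ D

end AlmostComplex

end Pluriharmonic

end

/-! For a real bilinear `B`, the (1,1)-part vanishes, or is symmetric, as soon as the real form B(u,
v) + B(Ju, Jv), here `addComp J B`, does (`oneOnePart_eq_zero_iff`, `oneOnePart_symm`). All the
geometry is therefore done with real tangent vectors.

Symmetry: since the Levi-Civita connection is torsion-free, ∇dφ(u, v) - ∇dφ(v, u) = -dφ(T(u, v))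
with T the torsion of D (`nablaDifferential_sub_swap`). Taking (1,1)-parts gives -dφ(T^{1,1}) = 0.
The formula is checked on coordinate fields, where it comes down to the symmetry of second
derivatives and of the Christoffel symbols.

Independence: let A = D - D' for two complex connections of Nijenhuis type. Then ∇dφ changes by
-dφ(A), so A^{1,1} = 0 suffices. The antisymmetrization of A is the difference of the torsions,
hence A^{1,1} is symmetric. As DJ = D'J = 0, A is J-linear in its second slot, so A(Z̄, W) has type
(1,0) and A(W, Z̄) has type (0,1). Being equal, both vanish (`addComp_eq_zero`, in real form). -/

noncomputable section

namespace Pluriharmonic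

open Bundle FiberBundle VectorField

/-! ### Linear algebra of (1,1)-parts. -/

section Algebra

variable {V : Type*} [AddCommGroup V] [Module ℝ V] {W : Type*} [AddCommGroup W] [Module ℝ W]

/-- The real bilinear map `B(X, Y) + B(JX, JY)`, which is twice the `(1,1)`-part of `B`. -/
def addComp (J : V →ₗ[ℝ] V) (B : V →ₗ[ℝ] V →ₗ[ℝ] W) : V →ₗ[ℝ] V →ₗ[ℝ] W := B + B.compl₁₂ J J

theorem addComp_apply (J : V →ₗ[ℝ] V) (B : V →ₗ[ℝ] V →ₗ[ℝ] W) (u v : V) :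
    addComp J B u v = B u v + B (J u) (J v) := rfl

theorem complexify_tmul (B : V →ₗ[ℝ] V →ₗ[ℝ] W) (a b : ℂ) (u v : V) :
    complexify B (a ⊗ₜ u) (b ⊗ₜ v) = (a * b) ⊗ₜ[ℝ] B u v :=
  LinearMap.BilinMap.baseChange_tmul B a u b v

/-- Expand u^{1,0} = (u - iJu)/2 and v^{0,1} = (v + iJv)/2: the mixed terms iB(u, Jv) and iB(Ju, v)
cancel between the two summands. -/
theorem oneOnePart_tmul (J : V →ₗ[ℝ] V) (B : V →ₗ[ℝ] V →ₗ[ℝ] W) (a b : ℂ) (u v : V) :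
    oneOnePart J B (a ⊗ₜ u) (b ⊗ₜ v) = (a * b / 2) ⊗ₜ[ℝ] addComp J B u v := by
  have h2 : (a * b / 2) = (1 / 2 : ℂ) • (a * b) := by rw [smul_eq_mul]; ring
  rw [h2, ← TensorProduct.smul_tmul', addComp_apply, TensorProduct.tmul_add]
  simp only [oneOnePart, proj10, proj01, LinearMap.add_apply, LinearMap.compl₁₂_apply,
    LinearMap.smul_apply, LinearMap.sub_apply, LinearMap.id_apply, LinearMap.baseChange_tmul,
    map_add, map_sub, map_smul, complexify_tmul]
  match_scalars <;> ring_nf <;> simp <;> ring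

theorem oneOnePart_eq_zero_iff (J : V →ₗ[ℝ] V) (B : V →ₗ[ℝ] V →ₗ[ℝ] W) :
    oneOnePart J B = 0 ↔ addComp J B = 0 := by
  constructor
  · intro H
    ext u v
    have h1 : (1 : ℂ) ⊗ₜ[ℝ] addComp J B u v = 0 := by
      -- The scalars 2 and 1 make the factor ab/2 equal to 1.
      have := oneOnePart_tmul J B 2 1 u v
      rw [H] at this
      simpa using this.symm
    -- Taking real parts in the factor ℂ is a left inverse of w ↦ 1 ⊗ w.
    have h2 := congrArg (TensorProduct.lid ℝ W ∘ Complex.reLm.rTensor W) h1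
    simpa using h2
  · intro H
    ext u v
    simpa [H] using oneOnePart_tmul J B 1 1 u v

theorem oneOnePart_symm {J : V →ₗ[ℝ] V} {B : V →ₗ[ℝ] V →ₗ[ℝ] W}
    (H : ∀ u v, addComp J B u v = addComp J B v u) (U U' : ℂ ⊗[ℝ] V) :
    oneOnePart J B U U' = oneOnePart J B U' U := by
  have : oneOnePart J B = (oneOnePart J B).flip := by
    ext u v
    simpa [H u v] using (oneOnePart_tmul J B 1 1 u v).trans <| .symm <|
      by simpa [H u v] using oneOnePart_tmul J B 1 1 v u
  exact LinearMap.congr_fun₂ this U U'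

theorem conj_baseChange (J : V →ₗ[ℝ] V) (Z : ℂ ⊗[ℝ] V) :
    J.baseChange ℂ (conj Z) = conj (J.baseChange ℂ Z) := by
  induction Z with
  | zero => simp
  | tmul a v => simp [conj]
  | add x y hx hy => simp only [map_add, hx, hy]

theorem conj_smul (c : ℂ) (Z : ℂ ⊗[ℝ] V) : conj (c • Z) = starRingEnd ℂ c • conj Z := by
  induction Z with
  | zero => simp
  | tmul a v => simp [conj, TensorProduct.smul_tmul']
  | add x y hx hy => simp only [map_add, smul_add, hx, hy]

theorem mem_type10 {J : V →ₗ[ℝ] V} {Z : ℂ ⊗[ℝ] V} :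
    Z ∈ type10 J ↔ J.baseChange ℂ Z = Complex.I • Z := Module.End.mem_eigenspace_iff

theorem baseChange_conj_of_mem_type10 {J : V →ₗ[ℝ] V} {Z : ℂ ⊗[ℝ] V} (hZ : Z ∈ type10 J) :
    J.baseChange ℂ (conj Z) = -(Complex.I • conj Z) := by
  rw [conj_baseChange, mem_type10.1 hZ, conj_smul, Complex.conj_I, neg_smul]

/-- `Z` has type (1,0) and `conj U` type (0,1), so the projections fix or kill them and one of the
two summands survives. This turns symmetry of the (1,1)-part into ∇dφ(Z, W̄) = ∇dφ(W̄, Z). -/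
theorem oneOnePart_conj {J : V →ₗ[ℝ] V} (B : V →ₗ[ℝ] V →ₗ[ℝ] W) {Z U : ℂ ⊗[ℝ] V}
    (hZ : Z ∈ type10 J) (hU : U ∈ type10 J) :
    oneOnePart J B Z (conj U) = complexify B Z (conj U) ∧
      oneOnePart J B (conj U) Z = complexify B (conj U) Z := by
  have hZ' := mem_type10.1 hZ
  have hU' := baseChange_conj_of_mem_type10 hU
  have e1 : proj10 J Z = Z := by
    simp only [proj10, LinearMap.smul_apply, LinearMap.sub_apply, LinearMap.id_apply, hZ', smul_smul,
      Complex.I_mul_I]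
    module
  have e2 : proj01 J Z = 0 := by
    simp only [proj01, LinearMap.smul_apply, LinearMap.add_apply, LinearMap.id_apply, hZ', smul_smul,
      Complex.I_mul_I]
    module
  have e3 : proj01 J (conj U) = conj U := by
    simp only [proj01, LinearMap.smul_apply, LinearMap.add_apply, LinearMap.id_apply, hU', smul_neg,
      smul_smul, Complex.I_mul_I]
    module
  have e4 : proj10 J (conj U) = 0 := by
    simp only [proj10, LinearMap.smul_apply, LinearMap.sub_apply, LinearMap.id_apply, hU', smul_neg,
      smul_smul, Complex.I_mul_I]
    module
  simp [oneOnePart, e1, e2, e3, e4]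

/-- A bilinear form `A` with `A(u, J v) = J A(u, v)` whose `(1,1)`-part is symmetric has no
`(1,1)`-part. -/
theorem addComp_eq_zero {J : V →ₗ[ℝ] V} (hJ : ∀ u, J (J u) = -u) {A : V →ₗ[ℝ] V →ₗ[ℝ] V}
    (hA : ∀ u v, A u (J v) = J (A u v)) (H : ∀ u v, addComp J A u v = addComp J A v u) :
    addComp J A = 0 := by
  ext u v
  have h1 : ∀ u v, addComp J A u (J v) = J (addComp J A u v) := by
    intro u v; simp only [addComp_apply, hA, map_add]
  have h2 : addComp J A (J u) v = -J (addComp J A u v) := by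
    simp only [addComp_apply, hA, map_add, hJ, map_neg, LinearMap.neg_apply]
    abel
  -- The form is J-linear in the second slot by `h1` and J-antilinear in the first by `h2`; symmetry
  -- exchanges the slots, so J of it equals its own negative.
  have h3 : J (addComp J A u v) = -J (addComp J A u v) := by
    rw [← h2, H (J u), h1, H]
  have h4 : J (addComp J A u v) = 0 := by
    have : (2 : ℝ) • J (addComp J A u v) = 0 := by
      rw [two_smul]; nth_rewrite 1 [h3]; exact neg_add_cancel _
    simpa using this
  have h5 := hJ (addComp J A u v)
  rw [h4, map_zero] at h5
  simpa using h5.symm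

end Algebra

/-! ### Coordinate frames of the tangent bundle. -/

section SecondDerivative

variable {F : Type*} [NormedAddCommGroup F] [NormedSpace ℝ F]
    {N : Type*} [TopologicalSpace N] [ChartedSpace F N] [IsManifold 𝓘(ℝ, F) ∞ N]

theorem isManifold_one : IsManifold 𝓘(ℝ, F) 1 N := .of_le (n := ∞) (by norm_cast)

theorem constField_apply {p q : N} (hq : q ∈ (chartAt F p).source) (w : F) :
    constField p w q = mfderiv[Set.range 𝓘(ℝ, F)] (extChartAt 𝓘(ℝ, F) p).symm
      (extChartAt 𝓘(ℝ, F) p q) w := by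
  have := isManifold_one (F := F) (N := N)
  exact DFunLike.congr_fun (TangentBundle.symmL_trivializationAt (I := 𝓘(ℝ, F)) hq) w

/-- The chart at `p` identifies the tangent space at `p` with the model space by the identity. -/
theorem constField_self (p : N) (w : F) : constField p w p = w := by
  have := isManifold_one (F := F) (N := N)
  rw [constField_apply (mem_chart_source F p)]
  exact DFunLike.congr_fun (mfderivWithin_range_extChartAt_symm (I := 𝓘(ℝ, F)) (x := p)) w

/-- The fields of a coordinate frame commute. -/
theorem mlieBracket_constField (p : N) (w w' : F) :
    mlieBracket 𝓘(ℝ, F) (constField p w) (constField p w') p = 0 := by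
  have := isManifold_one (F := F) (N := N)
  have key : ∀ w : F, mpullbackWithin 𝓘(ℝ, F) 𝓘(ℝ, F) (extChartAt 𝓘(ℝ, F) p).symm
      (constField p w) (Set.range 𝓘(ℝ, F)) =ᶠ[nhds (extChartAt 𝓘(ℝ, F) p p)] fun _ ↦ w := by
    intro w
    filter_upwards [extChartAt_target_mem_nhds (I := 𝓘(ℝ, F)) p] with z hz
    have hz' : (extChartAt 𝓘(ℝ, F) p).symm z ∈ (chartAt F p).source := by
      rw [← extChartAt_source 𝓘(ℝ, F)]; exact (extChartAt 𝓘(ℝ, F) p).map_target hz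
    rw [mpullbackWithin_apply, constField_apply hz', (extChartAt 𝓘(ℝ, F) p).right_inv hz]
    -- Read in the chart, the field is the inverse chart's derivative applied to `w`, then undone by
    -- its inverse: a constant field. Constant fields have zero bracket.
    obtain ⟨e, he⟩ := isInvertible_mfderivWithin_extChartAt_symm (I := 𝓘(ℝ, F)) hz
    rw [← he, ContinuousLinearMap.inverse_equiv]
    exact e.symm_apply_apply w
  rw [← mlieBracketWithin_univ, mlieBracketWithin_apply]
  have h0 : lieBracketWithin ℝ
      (mpullbackWithin 𝓘(ℝ, F) 𝓘(ℝ, F) (extChartAt 𝓘(ℝ, F) p).symm (constField p w)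
        (Set.range 𝓘(ℝ, F)))
      (mpullbackWithin 𝓘(ℝ, F) 𝓘(ℝ, F) (extChartAt 𝓘(ℝ, F) p).symm (constField p w')
        (Set.range 𝓘(ℝ, F)))
      ((extChartAt 𝓘(ℝ, F) p).symm ⁻¹' Set.univ ∩ Set.range 𝓘(ℝ, F))
      (extChartAt 𝓘(ℝ, F) p p) = 0 := by
    refine (Filter.EventuallyEq.lieBracketWithin_vectorField_eq
      ((key w).filter_mono nhdsWithin_le_nhds) (key w).self_of_nhds
      ((key w').filter_mono nhdsWithin_le_nhds) (key w').self_of_nhds).trans ?_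
    simp [lieBracketWithin]
  rw [h0]
  exact map_zero _

/-! ### The second derivative of φ in charts. -/

variable {E : Type*} [NormedAddCommGroup E] [NormedSpace ℝ E]
  {M : Type*} [TopologicalSpace M] [ChartedSpace E M] [IsManifold 𝓘(ℝ, E) ∞ M]
  (φ : C^∞⟮𝓘(ℝ, E), M; 𝓘(ℝ, F), N⟯)

/-- The expression of `φ` in the charts around `x` and `φ x`. -/
def inCharts (x : M) : E → F :=
  extChartAt 𝓘(ℝ, F) (φ x) ∘ φ ∘ (extChartAt 𝓘(ℝ, E) x).symm

omit [IsManifold 𝓘(ℝ, F) ∞ N] [IsManifold 𝓘(ℝ, E) ∞ M] in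
theorem contDiffAt_inCharts (x : M) : ContDiffAt ℝ ∞ (inCharts φ x) (extChartAt 𝓘(ℝ, E) x x) := by
  have := (contMDiffAt_iff.1 (φ.contMDiff x)).2
  simpa [contDiffWithinAt_univ] using! this

/-- Chain rule: the coordinate field is the derivative of the inverse chart on M, and the
trivialization of TN is the derivative of the chart on N. Only a neighbourhood of `x` mapped into
the chart domain around φ x is concerned, hence the germ equality. -/
theorem coord_mfderiv_constField (x : M) (v : E) :
    coord φ (fun y ↦ mfderiv 𝓘(ℝ, E) 𝓘(ℝ, F) φ y (constField x v y)) x =ᶠ[nhds x]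
      fun y ↦ fderiv ℝ (inCharts φ x) (extChartAt 𝓘(ℝ, E) x y) v := by
  have := isManifold_one (F := F) (N := N)
  have := isManifold_one (F := E) (N := M)
  filter_upwards [chart_source_mem_nhds E x, (map_continuous φ).continuousAt.eventually_mem
    (chart_source_mem_nhds F (φ x))] with y hy hφy
  have hy' : y ∈ (extChartAt 𝓘(ℝ, E) x).source := by rwa [extChartAt_source]
  obtain ⟨z, hz, rfl⟩ : ∃ z ∈ (extChartAt 𝓘(ℝ, E) x).target, (extChartAt 𝓘(ℝ, E) x).symm z = y :=
    ⟨_, (extChartAt 𝓘(ℝ, E) x).map_source hy', (extChartAt 𝓘(ℝ, E) x).left_inv hy'⟩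
  have d1 : MDiffAt (extChartAt 𝓘(ℝ, E) x).symm z := by
    have := mdifferentiableWithinAt_extChartAt_symm hz
    rwa [modelWithCornersSelf_coe, Set.range_id, mdifferentiableWithinAt_univ] at this
  have d2 : MDiffAt φ ((extChartAt 𝓘(ℝ, E) x).symm z) :=
    (φ.contMDiff _).mdifferentiableAt (by simp)
  have d3 : MDiffAt (extChartAt 𝓘(ℝ, F) (φ x)) (φ ((extChartAt 𝓘(ℝ, E) x).symm z)) :=
    mdifferentiableAt_extChartAt hφy
  have e1 := (d3.hasMFDerivAt.comp z (d2.hasMFDerivAt.comp z d1.hasMFDerivAt)).mfderiv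
  have e2 := TangentBundle.continuousLinearMapAt_trivializationAt (I := 𝓘(ℝ, F)) hφy
  have e3 : mfderiv[Set.range 𝓘(ℝ, E)] (extChartAt 𝓘(ℝ, E) x).symm z =
      mfderiv% (extChartAt 𝓘(ℝ, E) x).symm z := by
    rw [modelWithCornersSelf_coe, Set.range_id, mfderivWithin_univ]
  simp only [coord]
  rw [constField_apply hy, (extChartAt 𝓘(ℝ, E) x).right_inv hz, e2, e3]
  have e4 : mfderiv% (inCharts φ x) z = fderiv ℝ (inCharts φ x) z := mfderiv_eq_fderiv
  exact (DFunLike.congr_fun e1 v).symm.trans (DFunLike.congr_fun e4 v)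

theorem mvfderiv_coord_mfderiv_constField (x : M) (u v : E) :
    d% (coord φ (fun y ↦ mfderiv 𝓘(ℝ, E) 𝓘(ℝ, F) φ y (constField x v y)) x) x u =
      fderiv ℝ (fderiv ℝ (inCharts φ x)) (extChartAt 𝓘(ℝ, E) x x) u v := by
  have := isManifold_one (F := E) (N := M)
  have h1 : DifferentiableAt ℝ (fderiv ℝ (inCharts φ x)) (extChartAt 𝓘(ℝ, E) x x) :=
    ((contDiffAt_inCharts φ x).fderiv_right (m := 1) (by norm_cast)).differentiableAt one_ne_zero
  have h2 := (h1.hasFDerivAt.clm_apply (hasFDerivAt_const v _)).hasMFDerivAt.comp x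
    (mdifferentiableAt_extChartAt (I := 𝓘(ℝ, E)) (mem_chart_source E x)).hasMFDerivAt
  simp only [mvfderiv, (coord_mfderiv_constField φ x v).mfderiv_eq]
  have h3 := DFunLike.congr_fun h2.mfderiv u
  -- The chart has identity derivative at its own centre, so no transition factor remains.
  rw [mfderiv_extChartAt_self] at h3
  refine Eq.trans h3 ?_
  rw [ContinuousLinearMap.comp_zero, zero_add]
  rfl

theorem mvfderiv_coord_symm (x : M) (u v : E) :
    d% (coord φ (fun y ↦ mfderiv 𝓘(ℝ, E) 𝓘(ℝ, F) φ y (constField x v y)) x) x u =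
      d% (coord φ (fun y ↦ mfderiv 𝓘(ℝ, E) 𝓘(ℝ, F) φ y (constField x u y)) x) x v := by
  rw [mvfderiv_coord_mfderiv_constField, mvfderiv_coord_mfderiv_constField]
  exact (contDiffAt_inCharts φ x).isSymmSndFDerivAt (by simp only [minSmoothness_of_isRCLikeNormedField]; norm_cast) u v

omit [IsManifold 𝓘(ℝ, E) ∞ M] in
theorem coord_self (σ : Π y : M, TangentSpace 𝓘(ℝ, F) (φ y)) (x : M) : coord φ σ x x = σ x := by
  have := isManifold_one (F := F) (N := N)
  rw [coord, TangentBundle.continuousLinearMapAt_trivializationAt (I := 𝓘(ℝ, F))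
    (mem_chart_source F (φ x)), mfderiv_extChartAt_self]
  rfl

/-! ### Torsion and the antisymmetric part of ∇dφ. -/

variable [FiniteDimensional ℝ F]
  (cov : CovariantDerivative 𝓘(ℝ, F) F (TangentSpace 𝓘(ℝ, F) : N → Type _))

/-- Coordinate fields commute, so the bracket term drops out. -/
theorem torsion_constField (p : N) (a b : TangentSpace 𝓘(ℝ, F) p) :
    cov.torsion p a b = cov (constField p b) p a - cov (constField p a) p b := by
  have h := cov.torsion_apply (mdifferentiableAt_constField (F := F) p a)
    (mdifferentiableAt_constField (F := F) p b)
  rw [constField_self (F := F) p a, constField_self (F := F) p b] at h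
  exact (h.trans (congrArg _ (mlieBracket_constField (F := F) p a b))).trans (sub_zero _)

/-- If `cov` is torsion-free, then so is the pull-back connection on `φ^*TN`. -/
theorem pullbackConnection_constField_symm (hcov : cov.torsion = 0) (x : M)
    (u v : TangentSpace 𝓘(ℝ, E) x) :
    pullbackConnection φ cov (fun y ↦ mfderiv 𝓘(ℝ, E) 𝓘(ℝ, F) φ y (constField (F := E) x v y)) x u =
      pullbackConnection φ cov (fun y ↦ mfderiv 𝓘(ℝ, E) 𝓘(ℝ, F) φ y (constField (F := E) x u y)) x v := by
  have key := torsion_constField cov (φ x) (mfderiv 𝓘(ℝ, E) 𝓘(ℝ, F) φ x u)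
    (mfderiv 𝓘(ℝ, E) 𝓘(ℝ, F) φ x v)
  rw [hcov] at key
  have key' := (sub_eq_zero.1 key.symm).symm
  -- At `x` itself, the coordinates of dφ of a coordinate field are just dφ of the vector.
  have e : ∀ a b : TangentSpace 𝓘(ℝ, E) x, cov (constField (φ x) (coord φ (fun y ↦
      mfderiv 𝓘(ℝ, E) 𝓘(ℝ, F) φ y (constField (F := E) x a y)) x x)) (φ x)
        (mfderiv 𝓘(ℝ, E) 𝓘(ℝ, F) φ x b) =
      cov (constField (φ x) (mfderiv 𝓘(ℝ, E) 𝓘(ℝ, F) φ x a)) (φ x)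
        (mfderiv 𝓘(ℝ, E) 𝓘(ℝ, F) φ x b) := fun a b ↦
    congrArg (fun c : F ↦ cov (constField (φ x) c) (φ x) (mfderiv 𝓘(ℝ, E) 𝓘(ℝ, F) φ x b))
      ((coord_self φ _ x).trans (congrArg _ (constField_self (F := E) x a)))
  simp only [pullbackConnection, add_apply, ContinuousLinearMap.comp_apply]
  -- The derivative term is symmetric by Schwarz; the Christoffel term that is left is symmetric
  -- because the torsion of `cov` vanishes.
  rw [mvfderiv_coord_symm φ x u v]
  exact congrArg _ ((e v u).trans ((sub_eq_zero.1 key.symm).trans (e u v).symm))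

variable [FiniteDimensional ℝ E]
  (D : CovariantDerivative 𝓘(ℝ, E) E (TangentSpace 𝓘(ℝ, E) : M → Type _))

/-- The antisymmetric part of `∇dφ` is `-dφ(T)`, for `T` the torsion of the connection on `M`. -/
theorem nablaDifferential_sub_swap (hcov : cov.torsion = 0) (x : M)
    (u v : TangentSpace 𝓘(ℝ, E) x) :
    nablaDifferential φ cov D x u v - nablaDifferential φ cov D x v u =
      -mfderiv 𝓘(ℝ, E) 𝓘(ℝ, F) φ x (torsionAt D x u v) := by
  have h1 := nablaDifferential_apply φ cov D u (mdifferentiableAt_constField (F := E) x v)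
  have h2 := nablaDifferential_apply φ cov D v (mdifferentiableAt_constField (F := E) x u)
  have h3 : torsionAt D x u v = _ := torsion_constField D x u v
  rw [constField_self (F := E) x v] at h1
  rw [constField_self (F := E) x u] at h2
  rw [h1, h2, h3, pullbackConnection_constField_symm φ cov hcov x u v, map_sub]
  abel

end SecondDerivative

/-! ### Comparison of two connections on M. -/

section Difference

variable {E : Type*} [NormedAddCommGroup E] [NormedSpace ℝ E] [FiniteDimensional ℝ E]
  {M : Type*} [TopologicalSpace M] [ChartedSpace E M] [IsManifold 𝓘(ℝ, E) ∞ M]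
  {F : Type*} [NormedAddCommGroup F] [NormedSpace ℝ F]
  {N : Type*} [TopologicalSpace N] [ChartedSpace F N] [IsManifold 𝓘(ℝ, F) ∞ N]
  (D D' : CovariantDerivative 𝓘(ℝ, E) E (TangentSpace 𝓘(ℝ, E) : M → Type _))

-- The terms df ⊗ Y of the two Leibniz rules cancel.
omit [FiniteDimensional ℝ E] in
theorem tensorialAt_sub (x : M) : TensorialAt 𝓘(ℝ, E) E
    (fun Y : Π y : M, TangentSpace 𝓘(ℝ, E) y ↦ D Y x - D' Y x) x where
  smul hf hY := by
    rw [D.isCovariantDerivativeOnUniv.leibniz hY hf, D'.isCovariantDerivativeOnUniv.leibniz hY hf,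
      add_sub_add_right_eq_sub, smul_sub]
  add hY hY' := by
    rw [D.isCovariantDerivativeOnUniv.add hY hY', D'.isCovariantDerivativeOnUniv.add hY hY',
      add_sub_add_comm]

/-- The difference of two connections on the tangent bundle. -/
def differenceAt (x : M) :
    TangentSpace 𝓘(ℝ, E) x →ₗ[ℝ] TangentSpace 𝓘(ℝ, E) x →ₗ[ℝ] TangentSpace 𝓘(ℝ, E) x :=
  (ContinuousLinearMap.coeLM ℝ ∘ₗ
    (TensorialAt.mkHom _ x (tensorialAt_sub D D' x)).toLinearMap).flip

theorem differenceAt_apply {x : M} (u : TangentSpace 𝓘(ℝ, E) x)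
    {Y : Π y : M, TangentSpace 𝓘(ℝ, E) y} (hY : MDiffAt (T% Y) x) :
    differenceAt D D' x u (Y x) = D Y x u - D' Y x u :=
  DFunLike.congr_fun (TensorialAt.mkHom_apply (tensorialAt_sub D D' x) hY) u

/-- The pull-back term involves only `cov`, so it cancels. -/
theorem nablaDifferential_sub (φ : C^∞⟮𝓘(ℝ, E), M; 𝓘(ℝ, F), N⟯)
    (cov : CovariantDerivative 𝓘(ℝ, F) F (TangentSpace 𝓘(ℝ, F) : N → Type _)) (x : M)
    (u v : TangentSpace 𝓘(ℝ, E) x) :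
    nablaDifferential φ cov D x u v - nablaDifferential φ cov D' x u v =
      -mfderiv 𝓘(ℝ, E) 𝓘(ℝ, F) φ x (differenceAt D D' x u v) := by
  have hv := mdifferentiableAt_constField (F := E) x v
  have h1 := nablaDifferential_apply φ cov D u hv
  have h2 := nablaDifferential_apply φ cov D' u hv
  have h3 := differenceAt_apply D D' u hv
  rw [constField_self (F := E) x v] at h1 h2 h3
  rw [h1, h2, h3, map_sub]
  abel

theorem torsionAt_sub (x : M) (u v : TangentSpace 𝓘(ℝ, E) x) :
    torsionAt D x u v - torsionAt D' x u v =
      differenceAt D D' x u v - differenceAt D D' x v u := by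
  have h1 : torsionAt D x u v = _ := torsion_constField D x u v
  have h2 : torsionAt D' x u v = _ := torsion_constField D' x u v
  have h3 := differenceAt_apply D D' u (mdifferentiableAt_constField (F := E) x v)
  have h4 := differenceAt_apply D D' v (mdifferentiableAt_constField (F := E) x u)
  rw [constField_self (F := E) x v] at h3
  rw [constField_self (F := E) x u] at h4
  rw [h1, h2, h3, h4]
  abel

omit [FiniteDimensional ℝ E] in
theorem AlmostComplexStructure.mdifferentiableAt (J : AlmostComplexStructure E M) {x : M}
    {Y : Π y : M, TangentSpace 𝓘(ℝ, E) y} (hY : MDiffAt (T% Y) x) :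
    MDiffAt (T% (fun y ↦ J y (Y y))) x :=
  MDifferentiableAt.clm_bundle_apply (F₁ := E) (F₂ := E)
    (E₁ := fun y : M ↦ TangentSpace 𝓘(ℝ, E) y) (E₂ := fun y : M ↦ TangentSpace 𝓘(ℝ, E) y)
    ((J.contMDiff x).mdifferentiableAt (by simp)) hY

variable {D D'}

/-- Each connection commutes with `J`, hence so does their difference; this is the J-linearity in
the second slot needed in `addComp_eq_zero`. -/
theorem IsComplexConnection.differenceAt_apply_J {J : AlmostComplexStructure E M}
    (hD : IsComplexConnection J D) (hD' : IsComplexConnection J D') (x : M)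
    (u v : TangentSpace 𝓘(ℝ, E) x) :
    differenceAt D D' x u (J x v) = J x (differenceAt D D' x u v) := by
  have hv := mdifferentiableAt_constField (F := E) x v
  have h1 := differenceAt_apply D D' u (J.mdifferentiableAt hv)
  have h2 := differenceAt_apply D D' u hv
  rw [hD.parallel hv, hD'.parallel hv, ← map_sub, ← h2] at h1
  rwa [constField_self (F := E) x v] at h1

/-- The crux of independence. Both torsions lack a (1,1)-part, so the (1,1)-part of the difference
is symmetric, and J-linearity in the second slot then kills it. -/
theorem IsNijenhuisType.addComp_differenceAt {J : AlmostComplexStructure E M}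
    (hD : IsNijenhuisType J D) (hD' : IsNijenhuisType J D') (x : M) :
    addComp (J x).toLinearMap (differenceAt D D' x) = 0 := by
  refine addComp_eq_zero (J.sq x)
    (hD.toIsComplexConnection.differenceAt_apply_J hD'.toIsComplexConnection x) fun u v ↦ ?_
  have h1 := LinearMap.congr_fun₂ ((oneOnePart_eq_zero_iff _ _).1 (hD.torsion_oneOne x)) u v
  have h2 := LinearMap.congr_fun₂ ((oneOnePart_eq_zero_iff _ _).1 (hD'.torsion_oneOne x)) u v
  have h3 := torsionAt_sub D D' x u v
  have h4 := torsionAt_sub D D' x (J x u) (J x v)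
  simp only [addComp_apply, LinearMap.zero_apply, ContinuousLinearMap.coe_coe] at h1 h2 ⊢
  rw [← sub_eq_zero, add_sub_add_comm, ← h3, ← h4, ← add_sub_add_comm, h1, h2, sub_zero]

theorem IsNijenhuisType.addComp_nablaDifferential_eq {J : AlmostComplexStructure E M}
    (hD : IsNijenhuisType J D) (hD' : IsNijenhuisType J D') (φ : C^∞⟮𝓘(ℝ, E), M; 𝓘(ℝ, F), N⟯)
    (cov : CovariantDerivative 𝓘(ℝ, F) F (TangentSpace 𝓘(ℝ, F) : N → Type _)) (x : M) :
    addComp (J x).toLinearMap (nablaDifferential φ cov D x) =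
      addComp (J x).toLinearMap (nablaDifferential φ cov D' x) := by
  ext u v
  have h1 := LinearMap.congr_fun₂ (hD.addComp_differenceAt hD' x) u v
  simp only [addComp_apply, LinearMap.zero_apply, ContinuousLinearMap.coe_coe] at h1 ⊢
  rw [← sub_eq_zero, add_sub_add_comm, nablaDifferential_sub, nablaDifferential_sub, ← neg_add,
    ← map_add, h1, map_zero, neg_zero]

/-- The antisymmetric part of ∇dφ is -dφ(T), whose (1,1)-part is -dφ(T^{1,1}) = 0. -/
theorem IsNijenhuisType.addComp_nablaDifferential_symm [FiniteDimensional ℝ F]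
    {J : AlmostComplexStructure E M} (hD : IsNijenhuisType J D)
    (φ : C^∞⟮𝓘(ℝ, E), M; 𝓘(ℝ, F), N⟯)
    {cov : CovariantDerivative 𝓘(ℝ, F) F (TangentSpace 𝓘(ℝ, F) : N → Type _)}
    (hcov : cov.torsion = 0) (x : M) (u v : TangentSpace 𝓘(ℝ, E) x) :
    addComp (J x).toLinearMap (nablaDifferential φ cov D x) u v =
      addComp (J x).toLinearMap (nablaDifferential φ cov D x) v u := by
  have h1 := LinearMap.congr_fun₂ ((oneOnePart_eq_zero_iff _ _).1 (hD.torsion_oneOne x)) u v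
  simp only [addComp_apply, LinearMap.zero_apply, ContinuousLinearMap.coe_coe] at h1 ⊢
  rw [← sub_eq_zero, add_sub_add_comm, nablaDifferential_sub_swap φ cov D hcov,
    nablaDifferential_sub_swap φ cov D hcov, ← neg_add, ← map_add, h1, map_zero, neg_zero]

variable (h : PseudoRiemannianMetric F N) (φ : C^∞⟮𝓘(ℝ, E), M; 𝓘(ℝ, F), N⟯)

theorem IsNijenhuisType.pluriharmonicEquation_iff [FiniteDimensional ℝ F]
    {J : AlmostComplexStructure E M} (hD : IsNijenhuisType J D) (hD' : IsNijenhuisType J D') :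
    PluriharmonicEquation J h φ D ↔ PluriharmonicEquation J h φ D' :=
  forall_congr' fun x ↦ by
    rw [oneOnePart_eq_zero_iff, oneOnePart_eq_zero_iff, hD.addComp_nablaDifferential_eq hD']

end Difference

end Pluriharmonic

end

open Pluriharmonic in
theorem mainTheorem7
    {E : Type*} [NormedAddCommGroup E] [NormedSpace ℝ E] [FiniteDimensional ℝ E]
    {M : Type*} [TopologicalSpace M] [ChartedSpace E M] [IsManifold 𝓘(ℝ, E) ∞ M]
    {F : Type*} [NormedAddCommGroup F] [NormedSpace ℝ F] [FiniteDimensional ℝ F]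
    {N : Type*} [TopologicalSpace N] [ChartedSpace F N] [IsManifold 𝓘(ℝ, F) ∞ N]
    (J : AlmostComplexStructure E M) (h : PseudoRiemannianMetric F N)
    (φ : C^∞⟮𝓘(ℝ, E), M; 𝓘(ℝ, F), N⟯) :
    (∀ D : CovariantDerivative 𝓘(ℝ, E) E (TangentSpace 𝓘(ℝ, E) : M → Type _),
      IsNijenhuisType J D → ∀ x : M,
        (∀ U V : ℂ ⊗[ℝ] TangentSpace 𝓘(ℝ, E) x,
          oneOnePart (J x).toLinearMap (nablaDifferential φ h.leviCivita D x) U V =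
            oneOnePart (J x).toLinearMap (nablaDifferential φ h.leviCivita D x) V U) ∧
        (∀ Z ∈ type10 (J x).toLinearMap, ∀ W ∈ type10 (J x).toLinearMap,
          complexify (nablaDifferential φ h.leviCivita D x) Z (conj W) =
            complexify (nablaDifferential φ h.leviCivita D x) (conj W) Z)) ∧
    (∀ D₁ D₂ : CovariantDerivative 𝓘(ℝ, E) E (TangentSpace 𝓘(ℝ, E) : M → Type _),
      IsNijenhuisType J D₁ → IsNijenhuisType J D₂ →
        (PluriharmonicEquation J h φ D₁ ↔ PluriharmonicEquation J h φ D₂)) ∧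
    (∀ D : CovariantDerivative 𝓘(ℝ, E) E (TangentSpace 𝓘(ℝ, E) : M → Type _),
      IsNijenhuisType J D →
        (IsGeneralizedPluriharmonic J h φ ↔ PluriharmonicEquation J h φ D)) := by
  refine ⟨fun D hD x ↦ ?_, fun D₁ D₂ h₁ h₂ ↦ h₁.pluriharmonicEquation_iff h φ h₂, fun D hD ↦ ?_⟩
  · have hs := oneOnePart_symm (hD.addComp_nablaDifferential_symm φ h.leviCivita_torsion x)
    refine ⟨hs, fun Z hZ W hW ↦ ?_⟩
    obtain ⟨h1, h2⟩ := oneOnePart_conj (nablaDifferential φ h.leviCivita D x) hZ hW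
    rw [← h1, ← h2, hs]
  -- The connection `D'` witnessing pluriharmonicity need not be `D`; independence transfers the
  -- equation.
  · exact ⟨fun ⟨D', hD', H⟩ ↦ (hD'.pluriharmonicEquation_iff h φ hD).1 H, fun H ↦ ⟨D, hD, H⟩⟩
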